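/- Let $X\subseteq\mathbb{R}^d$ be closed and let $\rho$ be a Borel probability measure on $X\times\mathbb{R}$ with $\int y^2\,d\rho<\infty$, marginal $\rho_X$ on $X$, conditional measures $\rho(\cdot\mid x)$, and regression function $f_\rho(x)=\int y\,d\rho(y\mid x)$. Write $\|f\|_\rho=\left(\int_X|f|^2\,d\rho_X\right)^{1/2}$ and $\mathcal{E}(f)=\int (f(x)-y)^2\,d\rho(x,y)$. Let $\mu$ be a probability measure on a measurable space $V$ and let $\phi:V\times X\to\mathbb{R}$, $\phi_v(x)=\phi(v,x)$, be measurable and square-integrable with respect to $\mu\otimes\rho_X$. Assume that the kernel $$K(x,x')=\int_V\phi_v(x)\,\phi_v(x')\,d\mu(v),\qquad x,x'\in X,$$ is well defined ($\phi(\cdot,x)\in L^2(\mu)$ for all $x \in X$) and measurable. Let $L_K f=\int_X f(x)K(x,\cdot)\,d\rho_X(x)$ be its integral operator on $L^2(\rho_X)$. Assume: 1. (Boundedness) There is $\kappa\ge 1$ such that $K(x,x)\le\kappa^2$ for $\rho_X$-almost every $x$, and $\phi_v(x)\phi_v(x')\le\kappa^2$ for $\mu\otimes\rho_X\otimes\rho_X$-almost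 every $(v,x,x')$. 2. (Source condition) There are $\zeta>0$, $R>0$ and $g\in L^2(\rho_X)$ with $\|g\|_\rho\le R$ and $f_\rho=L_K^{\zeta}g$ $\rho_X$-almost everywhere; that is, $\|L_K^{-\zeta}f_\rho\|_\rho\le R$. Let $T\ge 2$ be an integer, and let $(x_t,y_t,v_t)$, $t=1,\dots,T$, be independent with common law $\rho\otimes\mu$. Let $f_1=0$ and $$f_{t+1}=f_t-\eta_t\,\bigl(f_t(x_t)-y_t\bigr)\,\phi_{v_t}(x_t)\,\phi_{v_t},\qquad \eta_t=\frac{\zeta}{8\kappa^4(\zeta+1)}\,T^{-\frac{2\zeta+1}{2\zeta+2}},\qquad t=1,\dots,T$$ (the doubly stochastic learning algorithm with regularization parameter $\lambda=0$). Then $$\mathbb{E}\bigl[\|f_{T+1}-f_\rho\|_\rho^2\bigr]\le C\,T^{-\frac{\zeta}{\zeta+1}}\ln T,$$ where the constant $C$ depends only on $R$, $\zeta$, $\|f_\rho\|_\rho$, $\mathcal{E}(f_\rho)$ and $\kappa^2$. -/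

import Mathlib

open MeasureTheory ProbabilityTheory
open scoped ENNReal NNReal

namespace DoublyStochastic

noncomputable section

/-! ### The integral operator of a kernel on `L²(ν)` -/

theorem sq_eLpNorm_two {Y : Type*} [MeasurableSpace Y] (m : Measure Y) (g : Y → ℝ) :
    eLpNorm g 2 m ^ 2 = ∫⁻ y, ‖g y‖ₑ ^ 2 ∂m := by
  have := eLpNorm_nnreal_pow_eq_lintegral (f := g) (μ := m) (p := 2) (by norm_num)
  simpa using this

theorem enorm_integral_kernel_le {X : Type*} [MeasurableSpace X] {ν : Measure X} {K : X → X → ℝ}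
    (u : X) (hu : AEStronglyMeasurable (fun x => K x u) ν) (f : Lp ℂ 2 ν) :
    ‖∫ x, (K x u : ℂ) * f x ∂ν‖ₑ ≤ eLpNorm (fun x => K x u) 2 ν * ‖f‖ₑ := by
  refine (enorm_integral_le_lintegral_enorm _).trans ?_
  rw [← eLpNorm_one_eq_lintegral_enorm, Lp.enorm_def]
  have h := eLpNorm_smul_le_mul_eLpNorm (p := 2) (q := 2) (r := 1)
    (Lp.aestronglyMeasurable f) hu
  refine le_trans (le_of_eq ?_) h
  congr 1

theorem integrable_kernel_mul {X : Type*} [MeasurableSpace X] {ν : Measure X}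
    {K : X → X → ℝ} {u : X} (hu : MemLp (fun x => K x u) 2 ν) (f : Lp ℂ 2 ν) :
    Integrable (fun x => (K x u : ℂ) * f x) ν :=
  hu.ofReal.integrable_mul (Lp.memLp f)

section IntegralOperator

variable {X : Type*} [MeasurableSpace X] {ν : Measure X} [SFinite ν] {K : X → X → ℝ}

theorem aestronglyMeasurable_section (hK : MemLp (Function.uncurry K) 2 (ν.prod ν)) :
    ∀ᵐ u ∂ν, AEStronglyMeasurable (fun x => K x u) ν :=
  hK.aestronglyMeasurable.prod_swap.prodMk_left

theorem lintegral_section (hK : MemLp (Function.uncurry K) 2 (ν.prod ν)) :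
    ∫⁻ u, eLpNorm (fun x => K x u) 2 ν ^ 2 ∂ν = eLpNorm (Function.uncurry K) 2 (ν.prod ν) ^ 2 := by
  simp_rw [sq_eLpNorm_two]
  rw [← lintegral_prod_swap, lintegral_prod]
  · rfl
  · exact (hK.aestronglyMeasurable.prod_swap.enorm).pow_const 2

theorem aemeasurable_section (hK : MemLp (Function.uncurry K) 2 (ν.prod ν)) :
    AEMeasurable (fun u => eLpNorm (fun x => K x u) 2 ν ^ 2) ν := by
  simp_rw [sq_eLpNorm_two]
  exact ((hK.aestronglyMeasurable.prod_swap.enorm).pow_const 2).lintegral_prod_right'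

theorem memLp_section (hK : MemLp (Function.uncurry K) 2 (ν.prod ν)) :
    ∀ᵐ u ∂ν, MemLp (fun x => K x u) 2 ν := by
  have hfin : ∫⁻ u, eLpNorm (fun x => K x u) 2 ν ^ 2 ∂ν ≠ ∞ := by
    rw [lintegral_section hK]
    exact ENNReal.pow_ne_top hK.eLpNorm_ne_top
  filter_upwards [aestronglyMeasurable_section hK, ae_lt_top' (aemeasurable_section hK) hfin]
    with u h1 h2
  exact ⟨h1, by simpa using h2⟩

theorem aestronglyMeasurable_integral (hK : MemLp (Function.uncurry K) 2 (ν.prod ν))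
    (f : Lp ℂ 2 ν) : AEStronglyMeasurable (fun u => ∫ x, (K x u : ℂ) * f x ∂ν) ν := by
  have h : AEStronglyMeasurable (fun p : X × X => (K p.2 p.1 : ℂ) * f p.2) (ν.prod ν) :=
    (Complex.continuous_ofReal.comp_aestronglyMeasurable hK.aestronglyMeasurable.prod_swap).mul
      (Lp.aestronglyMeasurable f).comp_snd
  exact h.integral_prod_right'

theorem eLpNorm_integral_le (hK : MemLp (Function.uncurry K) 2 (ν.prod ν)) (f : Lp ℂ 2 ν) :
    eLpNorm (fun u => ∫ x, (K x u : ℂ) * f x ∂ν) 2 ν ≤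
      eLpNorm (Function.uncurry K) 2 (ν.prod ν) * ‖f‖ₑ := by
  have h0 : eLpNorm (fun u => ∫ x, (K x u : ℂ) * f x ∂ν) 2 ν =
      eLpNorm (fun u => ‖∫ x, (K x u : ℂ) * f x ∂ν‖) 2 ν := (eLpNorm_norm _).symm
  rw [h0, ← ENNReal.pow_le_pow_left_iff two_ne_zero, sq_eLpNorm_two, mul_pow,
    ← lintegral_section hK, ← lintegral_mul_const'' _ (aemeasurable_section hK)]
  refine lintegral_mono_ae ?_
  filter_upwards [aestronglyMeasurable_section hK] with u hu
  rw [← mul_pow, enorm_norm]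
  gcongr
  exact enorm_integral_kernel_le u hu f

theorem memLp_integral (hK : MemLp (Function.uncurry K) 2 (ν.prod ν)) (f : Lp ℂ 2 ν) :
    MemLp (fun u => ∫ x, (K x u : ℂ) * f x ∂ν) 2 ν :=
  ⟨aestronglyMeasurable_integral hK f, (eLpNorm_integral_le hK f).trans_lt
    (ENNReal.mul_lt_top hK.eLpNorm_lt_top enorm_lt_top)⟩

/-- The integral operator `f ↦ ∫ f(x) K(x, ·) dν(x)` of a square-integrable kernel, as a bounded
operator on the complex Hilbert space `L²(ν)`. -/
def integralOperatorOfMemLp (ν : Measure X) [SFinite ν] (K : X → X → ℝ)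
    (hK : MemLp (Function.uncurry K) 2 (ν.prod ν)) : Lp ℂ 2 ν →L[ℂ] Lp ℂ 2 ν :=
  LinearMap.mkContinuous
    { toFun := fun f => (memLp_integral hK f).toLp _
      map_add' := fun f g => by
        rw [← MemLp.toLp_add]
        refine MemLp.toLp_congr _ _ ?_
        filter_upwards [memLp_section hK] with u hu
        simp only [Pi.add_apply]
        rw [← integral_add (integrable_kernel_mul hu f) (integrable_kernel_mul hu g)]
        refine integral_congr_ae ?_
        filter_upwards [Lp.coeFn_add f g] with x hx
        rw [hx, Pi.add_apply, mul_add]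
      map_smul' := fun c f => by
        rw [RingHom.id_apply, ← MemLp.toLp_const_smul]
        refine MemLp.toLp_congr _ _ (Filter.Eventually.of_forall fun u => ?_)
        simp only [Pi.smul_apply]
        rw [← integral_smul]
        refine integral_congr_ae ?_
        filter_upwards [Lp.coeFn_smul c f] with x hx
        rw [hx, Pi.smul_apply, smul_eq_mul, smul_eq_mul]
        ring }
    (eLpNorm (Function.uncurry K) 2 (ν.prod ν)).toReal
    (fun f => by
      have h := eLpNorm_integral_le hK f
      rw [LinearMap.coe_mk, AddHom.coe_mk, Lp.norm_toLp]
      refine (ENNReal.toReal_mono (ENNReal.mul_ne_top hK.eLpNorm_ne_top enorm_ne_top) h).trans ?_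
      rw [ENNReal.toReal_mul, toReal_enorm])

open Classical in
/-- The integral operator `L_K f = ∫ f(x) K(x, ·) dν(x)` on `L²(ν)`. Outside the class of
square-integrable kernels it has the irrelevant value `0`; a bounded measurable kernel on a
probability space is square-integrable. -/
def integralOperator (ν : Measure X) [SFinite ν] (K : X → X → ℝ) : Lp ℂ 2 ν →L[ℂ] Lp ℂ 2 ν :=
  if hK : MemLp (Function.uncurry K) 2 (ν.prod ν) then integralOperatorOfMemLp ν K hK else 0

theorem integralOperator_apply (hK : MemLp (Function.uncurry K) 2 (ν.prod ν)) (f : Lp ℂ 2 ν) :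
    integralOperator ν K f =ᵐ[ν] fun u => ∫ x, (K x u : ℂ) * f x ∂ν := by
  rw [integralOperator, dif_pos hK]
  exact (memLp_integral hK f).coeFn_toLp

end IntegralOperator

/-! ### Least squares regression -/

section Regression

variable {X : Type*} [MeasurableSpace X]

/-- The regression function `f_ρ(x) = ∫ y dρ(y | x)`. -/
def regressionFunction (ρ : Measure (X × ℝ)) [IsFiniteMeasure ρ] (x : X) : ℝ :=
  ∫ y, y ∂(ρ.condKernel x)

/-- The expected risk `∫ (f(x) - y)² dρ(x, y)` of `f`. -/
def expectedRisk (ρ : Measure (X × ℝ)) (f : X → ℝ) : ℝ :=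
  ∫ p, (f p.1 - p.2) ^ 2 ∂ρ

/-- The real power `A ^ ζ` of a positive bounded operator on a complex Hilbert space, given by the
continuous functional calculus. -/
def operatorPow {H : Type*} [NormedAddCommGroup H] [InnerProductSpace ℂ H] [CompleteSpace H]
    (A : H →L[ℂ] H) (ζ : ℝ) : H →L[ℂ] H :=
  CFC.rpow A ζ

/-- The source condition `‖L_K^{-ζ} f‖ ≤ R`: there is a real-valued `g ∈ L²(ν)` with `‖g‖ ≤ R` and
`f = L_K^ζ g`. The power is taken in the complexification `L²(ν; ℂ)` of the real space `L²(ν; ℝ)`. -/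
def SourceCondition (ν : Measure X) [SFinite ν] (K : X → X → ℝ) (ζ R : ℝ) (f : X → ℝ) : Prop :=
  ∃ g : Lp ℝ 2 ν, ‖g‖ ≤ R ∧
    operatorPow (integralOperator ν K) ζ (Complex.ofRealCLM.compLp g) =ᵐ[ν] fun x => (f x : ℂ)

end Regression

/-- The kernel `K` is generated by the random features `φ(v, ·)`, `v ∼ μ`:
`K(x, x') = ∫ φ(v, x) φ(v, x') dμ(v) = ⟨φ(·, x), φ(·, x')⟩` in `L²(μ)`, for a measurable function
`φ` on `V × X` that is square-integrable with respect to `μ ⊗ ν`. -/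
structure IsRandomFeatureKernel {V X : Type*} [MeasurableSpace V] [MeasurableSpace X]
    (μ : Measure V) (ν : Measure X) (φ : V → X → ℝ) (K : X → X → ℝ) : Prop where
  measurable_feature : Measurable (Function.uncurry φ)
  memLp_feature : MemLp (Function.uncurry φ) 2 (μ.prod ν)
  memLp_section : ∀ x, MemLp (fun v => φ v x) 2 μ
  kernel_eq : ∀ x x', K x x' = ∫ v, φ v x * φ v x' ∂μ

/-- The boundedness assumption: `K(x, x) ≤ κ²` and `φ(v, x) φ(v, x') ≤ κ²` almost surely. -/
structure IsBoundedFeature {V X : Type*} [MeasurableSpace V] [MeasurableSpace X]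
    (μ : Measure V) (ν : Measure X) (φ : V → X → ℝ) (K : X → X → ℝ) (κ : ℝ) : Prop where
  measurable_kernel : Measurable (Function.uncurry K)
  one_le : 1 ≤ κ
  kernel_le : ∀ᵐ x ∂ν, K x x ≤ κ ^ 2
  feature_le : ∀ᵐ p ∂(μ.prod (ν.prod ν)), φ p.1 p.2.1 * φ p.1 p.2.2 ≤ κ ^ 2

/-- The doubly stochastic learning algorithm with features `φ`, regularization parameter `lam` and
step sizes `η`, run on the examples `z t = (x_t, y_t)` and the feature parameters `v t`. Steps are
counted from `0` here, so that `iterate … t` is the function obtained after `t` steps. -/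
def iterate {V X : Type*} (φ : V → X → ℝ) (lam : ℝ) (η : ℕ → ℝ) (z : ℕ → X × ℝ) (v : ℕ → V) :
    ℕ → X → ℝ
  | 0 => fun _ => 0
  | t + 1 => fun u =>
      (1 - η t * lam) * iterate φ lam η z v t u -
        η t * (iterate φ lam η z v t (z t).1 - (z t).2) * φ (v t) (z t).1 * φ (v t) u

end

end DoublyStochastic

/-! Write `r` for the regression function and `L` for the integral operator. The random run is
compared with the deterministic gradient iteration for the target `r`, also started at zero, whose
residual after `t` steps is `(1 - ηL)^t (-r)`.

Given the past, the stochastic gradient is an unbiased estimate of `L (f_t - r)`, and its second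
moment at almost every point is at most `κ^4` times the risk of `f_t`, which is `‖f_t - r‖² + E`
with `E` the risk of `r`. Since `0 ≤ ηL ≤ 1`, the map `1 - ηL` is nonexpansive. So for any
deterministic `q`, replacing `f_t - r - q` by `f_{t+1} - r - (1 - ηL) q` increases the expected
squared norm by at most `η²κ⁴ (E‖f_t - r‖² + E)` (`lintegral_step_le`, `lintegral_iterate_succ_le`).

This estimate is used twice. With `q = 0` it is a Grönwall recursion, and as `T η² κ⁴ ≤ 1` the
quantities `E‖f_t - r‖² + E` stay within a factor 3 of the initial one. With `q` the population
residual it then bounds the expected squared distance between the two iterations by a constant times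
`T η² κ⁴`. The population residual is the bias: by the source condition it equals `(1 - ηL)^T L^ζ`
applied to `-g`, and functional calculus gives `(ζ/(ηT))^ζ R` (`eLpNorm_populationResidual_le`). The
step size makes both squared errors of order `T^(-ζ/(ζ+1))`; the logarithm in the theorem is not
needed by this argument. -/

namespace DoublyStochastic

/-! ### Almost sure feature bounds; positivity and norm of the integral operator. -/

section Feature

variable {V X : Type*} [MeasurableSpace V] [MeasurableSpace X]

/-- On the square of `{g > κ}`, and on that of `{g < -κ}`, the product exceeds `κ²`. A square `A ×ˢ
A` of measure zero forces `ν A = 0`. This turns the one-sided bound on products of features into a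
bound on each feature. -/
theorem ae_abs_le_of_ae_mul_le {ν : Measure X} [SFinite ν] {g : X → ℝ} {κ : ℝ} (hκ : 0 ≤ κ)
    (h : ∀ᵐ p ∂ν.prod ν, g p.1 * g p.2 ≤ κ ^ 2) : ∀ᵐ x ∂ν, |g x| ≤ κ := by
  have key : ∀ A : Set X, (∀ x ∈ A, ∀ x' ∈ A, κ ^ 2 < g x * g x') → ν A = 0 := by
    intro A hA
    have h0 : ν.prod ν (A ×ˢ A) = 0 := by
      refine measure_mono_null ?_ (ae_iff.1 h)
      rintro ⟨x, x'⟩ ⟨hx, hx'⟩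
      exact not_le.2 (hA x hx x' hx')
    rw [Measure.prod_prod] at h0
    simpa using h0
  have h1 : ∀ᵐ x ∂ν, ¬ κ < g x := by
    rw [ae_iff]
    simp only [not_not]
    refine key _ fun x hx x' hx' => ?_
    simp only [Set.mem_ofPred_eq] at hx hx'
    nlinarith
  have h2 : ∀ᵐ x ∂ν, ¬ g x < -κ := by
    rw [ae_iff]
    simp only [not_not]
    refine key _ fun x hx x' hx' => ?_
    simp only [Set.mem_ofPred_eq] at hx hx'
    nlinarith
  filter_upwards [h1, h2] with x hx hx'
  exact abs_le.2 ⟨not_lt.1 hx', not_lt.1 hx⟩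

variable {μ : Measure V} {ν : Measure X} {φ : V → X → ℝ} {K : X → X → ℝ} {κ : ℝ}

theorem IsRandomFeatureKernel.kernel_symm (hK : IsRandomFeatureKernel μ ν φ K) (x x' : X) :
    K x x' = K x' x := by
  rw [hK.kernel_eq, hK.kernel_eq]
  simp_rw [mul_comm]

variable [IsProbabilityMeasure ν]

theorem IsBoundedFeature.ae_abs_feature_le (hB : IsBoundedFeature μ ν φ K κ)
    (hK : IsRandomFeatureKernel μ ν φ K) : ∀ᵐ p ∂μ.prod ν, |φ p.1 p.2| ≤ κ := by
  have hm : MeasurableSet {p : V × X | |φ p.1 p.2| ≤ κ} :=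
    measurableSet_le (hK.measurable_feature.abs) measurable_const
  rw [Measure.ae_prod_iff_ae_ae hm]
  filter_upwards [Measure.ae_ae_of_ae_prod hB.feature_le] with v hv
  exact ae_abs_le_of_ae_mul_le (by linarith [hB.one_le]) hv

variable [IsProbabilityMeasure μ]

theorem IsBoundedFeature.ae_ae_abs_feature_le (hB : IsBoundedFeature μ ν φ K κ)
    (hK : IsRandomFeatureKernel μ ν φ K) : ∀ᵐ x ∂ν, ∀ᵐ v ∂μ, |φ v x| ≤ κ :=
  Measure.ae_ae_of_ae_prod
    ((Measure.measurePreserving_swap (μ := ν) (ν := μ)).quasiMeasurePreserving.ae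
      (hB.ae_abs_feature_le hK))

theorem IsBoundedFeature.ae_abs_kernel_le (hB : IsBoundedFeature μ ν φ K κ)
    (hK : IsRandomFeatureKernel μ ν φ K) : ∀ᵐ p ∂ν.prod ν, |K p.1 p.2| ≤ κ ^ 2 := by
  have h := hB.ae_ae_abs_feature_le hK
  filter_upwards [Measure.quasiMeasurePreserving_fst.ae h,
    Measure.quasiMeasurePreserving_snd.ae h] with p h1 h2
  rw [hK.kernel_eq, ← Real.norm_eq_abs]
  have := norm_integral_le_of_norm_le_const (μ := μ) (f := fun v => φ v p.1 * φ v p.2)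
    (C := κ ^ 2) (by
      filter_upwards [h1, h2] with v hv1 hv2
      rw [norm_mul, Real.norm_eq_abs, Real.norm_eq_abs, sq]
      exact mul_le_mul hv1 hv2 (abs_nonneg _) (by linarith [hB.one_le]))
  simpa using this

theorem IsBoundedFeature.memLp_kernel (hB : IsBoundedFeature μ ν φ K κ)
    (hK : IsRandomFeatureKernel μ ν φ K) : MemLp (Function.uncurry K) 2 (ν.prod ν) :=
  MemLp.of_bound hB.measurable_kernel.aestronglyMeasurable (κ ^ 2) (hB.ae_abs_kernel_le hK)

/-- The operator norm is at most the `L²` norm of the kernel, which for a probability measure is at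
most its almost sure bound. -/
theorem IsBoundedFeature.norm_integralOperator_le (hB : IsBoundedFeature μ ν φ K κ)
    (hK : IsRandomFeatureKernel μ ν φ K) : ‖integralOperator ν K‖ ≤ κ ^ 2 := by
  have hM := hB.memLp_kernel hK
  rw [integralOperator, dif_pos hM]
  refine (LinearMap.mkContinuous_norm_le _ ENNReal.toReal_nonneg _).trans ?_
  refine ENNReal.toReal_le_of_le_ofReal (by positivity) ?_
  simpa using eLpNorm_le_of_ae_bound (p := 2) (f := Function.uncurry K) (C := κ ^ 2)
    (hB.ae_abs_kernel_le hK)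

/-- Fubini over `v` and the two copies of `X`: for fixed `v` the double integral factors into a
number times its conjugate. This makes the operator positive, as the functional calculus requires.
-/
theorem IsBoundedFeature.inner_integralOperator (hB : IsBoundedFeature μ ν φ K κ)
    (hK : IsRandomFeatureKernel μ ν φ K) (f : Lp ℂ 2 ν) :
    inner ℂ (integralOperator ν K f) f =
      ((∫ v, ‖∫ x, (φ v x : ℂ) * f x ∂ν‖ ^ 2 ∂μ : ℝ) : ℂ) := by
  have hM := hB.memLp_kernel hK
  have hf : Integrable f ν := (Lp.memLp f).integrable (by norm_num)
  have hφ : ∀ᵐ p ∂μ.prod (ν.prod ν), ‖(φ p.1 p.2.1 : ℂ) * φ p.1 p.2.2‖ ≤ κ ^ 2 := by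
    have h := hB.ae_abs_feature_le hK
    have h1 : ∀ᵐ p ∂μ.prod (ν.prod ν), |φ p.1 p.2.1| ≤ κ :=
      ((MeasurePreserving.id μ).prod
        (measurePreserving_fst (μ := ν) (ν := ν))).quasiMeasurePreserving.ae h
    have h2 : ∀ᵐ p ∂μ.prod (ν.prod ν), |φ p.1 p.2.2| ≤ κ :=
      ((MeasurePreserving.id μ).prod
        (measurePreserving_snd (μ := ν) (ν := ν))).quasiMeasurePreserving.ae h
    filter_upwards [h1, h2] with p h1 h2
    rw [norm_mul, Complex.norm_real, Complex.norm_real, Real.norm_eq_abs, Real.norm_eq_abs, sq]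
    exact mul_le_mul h1 h2 (abs_nonneg _) (by linarith [hB.one_le])
  have hφm := hK.measurable_feature
  have hm : AEStronglyMeasurable
      (fun p : V × (X × X) => (φ p.1 p.2.1 : ℂ) * φ p.1 p.2.2) (μ.prod (ν.prod ν)) := by
    have e1 : Measurable fun p : V × (X × X) => φ p.1 p.2.1 :=
      hφm.comp (measurable_fst.prodMk measurable_snd.fst)
    have e2 : Measurable fun p : V × (X × X) => φ p.1 p.2.2 :=
      hφm.comp (measurable_fst.prodMk measurable_snd.snd)
    exact (e1.complex_ofReal.mul e2.complex_ofReal).aestronglyMeasurable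
  have hff : Integrable (fun p : X × X => f p.1 * starRingEnd ℂ (f p.2)) (ν.prod ν) :=
    hf.mul_prod (Complex.conjCLE.toContinuousLinearMap.integrable_comp hf)
  have hint : Integrable (fun p : V × (X × X) => ((φ p.1 p.2.1 : ℂ) * φ p.1 p.2.2) *
      (f p.2.1 * starRingEnd ℂ (f p.2.2))) (μ.prod (ν.prod ν)) :=
    (hff.comp_snd μ).bdd_mul hm hφ
  have hswap : ∫ p, ∫ v, ((φ v p.1 : ℂ) * φ v p.2) * (f p.1 * starRingEnd ℂ (f p.2)) ∂μ ∂ν.prod ν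
      = ∫ v, ∫ p, ((φ v p.1 : ℂ) * φ v p.2) * (f p.1 * starRingEnd ℂ (f p.2)) ∂ν.prod ν ∂μ :=
    (integral_integral_swap (f := fun v (p : X × X) =>
      ((φ v p.1 : ℂ) * φ v p.2) * (f p.1 * starRingEnd ℂ (f p.2))) hint).symm
  have hright : ∀ v, ∫ p, ((φ v p.1 : ℂ) * φ v p.2) * (f p.1 * starRingEnd ℂ (f p.2)) ∂ν.prod ν
      = ((‖∫ x, (φ v x : ℂ) * f x ∂ν‖ ^ 2 : ℝ) : ℂ) := by
    intro v
    have : ∫ p, ((φ v p.1 : ℂ) * φ v p.2) * (f p.1 * starRingEnd ℂ (f p.2)) ∂ν.prod ν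
        = ∫ p : X × X, ((φ v p.1 : ℂ) * f p.1) * starRingEnd ℂ ((φ v p.2 : ℂ) * f p.2)
          ∂ν.prod ν := by
      congr 1; ext p; simp; ring
    rw [this, integral_prod_mul (fun x => (φ v x : ℂ) * f x)
      (fun x => starRingEnd ℂ ((φ v x : ℂ) * f x)), integral_conj, Complex.mul_conj,
      Complex.normSq_eq_norm_sq]
  have hleft : ∀ p : X × X,
      ∫ v, ((φ v p.1 : ℂ) * φ v p.2) * (f p.1 * starRingEnd ℂ (f p.2)) ∂μ =
        (K p.1 p.2 : ℂ) * (f p.1 * starRingEnd ℂ (f p.2)) := by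
    intro p
    rw [integral_mul_const, hK.kernel_eq, ← integral_complex_ofReal]
    simp
  simp_rw [hright, hleft] at hswap
  rw [integral_complex_ofReal] at hswap
  refine Eq.trans ?_ hswap
  have hKf : Integrable (fun p : X × X => (K p.1 p.2 : ℂ) * (f p.1 * starRingEnd ℂ (f p.2)))
      (ν.prod ν) := by
    refine hff.bdd_mul (c := κ ^ 2) ?_ ?_
    · exact (Complex.measurable_ofReal.comp hB.measurable_kernel).aestronglyMeasurable
    · filter_upwards [hB.ae_abs_kernel_le hK] with p hp
      simpa using hp
  rw [L2.inner_def, integral_prod _ hKf]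
  refine integral_congr_ae ?_
  filter_upwards [integralOperator_apply hM f] with u hu
  rw [hu, RCLike.inner_apply, ← integral_conj, ← integral_const_mul]
  refine integral_congr_ae (Filter.Eventually.of_forall fun x => ?_)
  simp only [map_mul, Complex.conj_ofReal, hK.kernel_symm u x]
  ring

theorem IsBoundedFeature.integralOperator_nonneg (hB : IsBoundedFeature μ ν φ K κ)
    (hK : IsRandomFeatureKernel μ ν φ K) : 0 ≤ integralOperator ν K := by
  rw [ContinuousLinearMap.nonneg_iff_isPositive, ContinuousLinearMap.isPositive_iff_complex]
  intro f
  rw [hB.inner_integralOperator hK f]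
  refine ⟨by simp, ?_⟩
  rw [RCLike.re_eq_complex_re, Complex.ofReal_re]
  exact integral_nonneg fun v => by positivity

end Feature

/-! ### Spectral bounds for `1 - ηA` with `A` a positive operator. -/

section Operator

variable {H : Type*} [NormedAddCommGroup H] [InnerProductSpace ℂ H] [CompleteSpace H]

/-- Raise `x/ζ ≤ exp (x/ζ)` to the power `ζ`. -/
theorem rpow_mul_exp_neg_le {x ζ : ℝ} (hx : 0 ≤ x) (hζ : 0 < ζ) :
    x ^ ζ * Real.exp (-x) ≤ ζ ^ ζ := by
  have h1 : x / ζ ≤ Real.exp (x / ζ) := by linarith [Real.add_one_le_exp (x / ζ)]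
  have h2 : (x / ζ) ^ ζ ≤ Real.exp x := by
    calc (x / ζ) ^ ζ ≤ Real.exp (x / ζ) ^ ζ := by gcongr
      _ = Real.exp x := by rw [← Real.exp_mul]; congr 1; field_simp
  rw [Real.div_rpow hx hζ.le, div_le_iff₀ (by positivity)] at h2
  calc x ^ ζ * Real.exp (-x) ≤ (Real.exp x * ζ ^ ζ) * Real.exp (-x) := by gcongr
    _ = ζ ^ ζ := by rw [Real.exp_neg]; field_simp

theorem one_sub_mul_pow_mul_rpow_le {η s ζ : ℝ} {n : ℕ} (hη : 0 < η) (hs : 0 ≤ s)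
    (h1 : η * s ≤ 1) (hζ : 0 < ζ) (hn : 0 < n) :
    (1 - η * s) ^ n * s ^ ζ ≤ (ζ / (η * n)) ^ ζ := by
  have hn' : (0 : ℝ) < n := by exact_mod_cast hn
  have h2 : (1 - η * s) ^ n ≤ Real.exp (-(η * n * s)) := by
    calc (1 - η * s) ^ n ≤ Real.exp (-(η * s)) ^ n := by
          gcongr
          linarith [Real.add_one_le_exp (-(η * s))]
      _ = Real.exp (-(η * n * s)) := by rw [← Real.exp_nat_mul]; congr 1; ring
  have h3 := rpow_mul_exp_neg_le (x := η * n * s) (by positivity) hζ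
  rw [Real.mul_rpow (by positivity) hs] at h3
  rw [Real.div_rpow hζ.le (by positivity), le_div_iff₀ (by positivity)]
  calc (1 - η * s) ^ n * s ^ ζ * (η * n) ^ ζ
      ≤ Real.exp (-(η * n * s)) * s ^ ζ * (η * n) ^ ζ := by gcongr
    _ ≤ ζ ^ ζ := by linarith

theorem mem_Icc_of_mem_spectrum {A : H →L[ℂ] H} (hA : 0 ≤ A) {s : ℝ} (hs : s ∈ spectrum ℝ A) :
    s ∈ Set.Icc 0 ‖A‖ := by
  refine ⟨spectrum_nonneg_of_nonneg hA hs, ?_⟩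
  have := spectrum.norm_le_norm_mul_of_mem hs
  calc s ≤ ‖s‖ := Real.le_norm_self s
    _ ≤ ‖A‖ * ‖(1 : H →L[ℂ] H)‖ := this
    _ ≤ ‖A‖ * 1 := by gcongr; exact ContinuousLinearMap.norm_id_le
    _ = ‖A‖ := mul_one _

theorem one_sub_smul_eq_cfc {A : H →L[ℂ] H} (hA : 0 ≤ A) (η : ℝ) :
    1 - η • A = cfc (fun s : ℝ => 1 - η * s) A := by
  have hsa : IsSelfAdjoint A := IsSelfAdjoint.of_nonneg hA
  rw [cfc_sub (fun _ : ℝ => (1 : ℝ)) (fun s => η * s) A, cfc_const_mul_id η A, cfc_const_one ℝ A]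

theorem norm_one_sub_smul_le {A : H →L[ℂ] H} (hA : 0 ≤ A) {η : ℝ} (hη : 0 ≤ η)
    (h1 : η * ‖A‖ ≤ 1) : ‖1 - η • A‖ ≤ 1 := by
  rw [one_sub_smul_eq_cfc hA]
  refine norm_cfc_le zero_le_one fun s hs => ?_
  obtain ⟨hs0, hs1⟩ := mem_Icc_of_mem_spectrum hA hs
  rw [Real.norm_eq_abs, abs_le]
  have := mul_le_mul_of_nonneg_left hs1 hη
  constructor <;> nlinarith [mul_nonneg hη hs0]

/-- Both factors are functions of `A`, so the norm is controlled by the scalar function `(1 - ηs)^n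
s^ζ` on the spectrum, which lies in `[0, ‖A‖]`. -/
theorem norm_one_sub_smul_pow_mul_operatorPow_le {A : H →L[ℂ] H} (hA : 0 ≤ A) {η ζ : ℝ} {n : ℕ}
    (hη : 0 < η) (h1 : η * ‖A‖ ≤ 1) (hζ : 0 < ζ) (hn : 0 < n) :
    ‖(1 - η • A) ^ n * operatorPow A ζ‖ ≤ (ζ / (η * n)) ^ ζ := by
  have hsa : IsSelfAdjoint A := IsSelfAdjoint.of_nonneg hA
  have hpow : operatorPow A ζ = cfc (fun s : ℝ => s ^ ζ) A := CFC.rpow_eq_cfc_real hA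
  have hc : Continuous fun s : ℝ => s ^ ζ := Real.continuous_rpow_const hζ.le
  rw [hpow, one_sub_smul_eq_cfc hA, ← cfc_pow _ n A, ← cfc_mul _ _ A]
  refine norm_cfc_le (by positivity) fun s hs => ?_
  obtain ⟨hs0, hs1⟩ := mem_Icc_of_mem_spectrum hA hs
  have hs2 : η * s ≤ 1 := (mul_le_mul_of_nonneg_left hs1 hη.le).trans h1
  rw [Real.norm_of_nonneg (mul_nonneg (pow_nonneg (by linarith) _) (Real.rpow_nonneg hs0 _))]
  exact one_sub_mul_pow_mul_rpow_le hη hs0 hs2 hζ hn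

end Operator

/-! ### Orthogonality of the regression residual and decomposition of the risk. -/

section LeastSquares

variable {X : Type*} [MeasurableSpace X] {ρ : Measure (X × ℝ)}

theorem measurePreserving_fst' : MeasurePreserving Prod.fst ρ ρ.fst := ⟨measurable_fst, rfl⟩

theorem memLp_snd (hy : Integrable (fun p : X × ℝ => p.2 ^ 2) ρ) :
    MemLp (fun p : X × ℝ => p.2) 2 ρ :=
  (memLp_two_iff_integrable_sq measurable_snd.aestronglyMeasurable).2 hy

theorem integral_comp_fst {g : X → ℝ} (hg : AEStronglyMeasurable g ρ.fst) :
    ∫ p, g p.1 ∂ρ = ∫ x, g x ∂ρ.fst :=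
  (integral_map measurable_fst.aemeasurable hg).symm

theorem eLpNorm_two_sq_eq_ofReal {Y : Type*} [MeasurableSpace Y] {m : Measure Y} {g : Y → ℝ}
    (hg : MemLp g 2 m) : eLpNorm g 2 m ^ 2 = ENNReal.ofReal (∫ y, g y ^ 2 ∂m) := by
  rw [sq_eLpNorm_two, ofReal_integral_eq_lintegral_ofReal hg.integrable_sq
    (Filter.Eventually.of_forall fun y => sq_nonneg _)]
  refine lintegral_congr fun y => ?_
  rw [Real.enorm_eq_ofReal_abs, ← ENNReal.ofReal_pow (abs_nonneg _), sq_abs]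

theorem memLp_residual (hy : Integrable (fun p : X × ℝ => p.2 ^ 2) ρ) {f : X → ℝ}
    (hf : MemLp f 2 ρ.fst) : MemLp (fun p : X × ℝ => f p.1 - p.2) 2 ρ :=
  (hf.comp_measurePreserving measurePreserving_fst').sub (memLp_snd hy)

variable [IsProbabilityMeasure ρ]

theorem measurable_regressionFunction : Measurable (regressionFunction ρ) :=
  (StronglyMeasurable.integral_kernel (κ := ρ.condKernel) (f := fun y : ℝ => y)
    stronglyMeasurable_id).measurable

theorem integral_mul_residual (hy : Integrable (fun p : X × ℝ => p.2 ^ 2) ρ) {k f : X → ℝ}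
    (hk : MemLp k 2 ρ.fst) (hf : MemLp f 2 ρ.fst) :
    ∫ p, k p.1 * (f p.1 - p.2) ∂ρ = ∫ x, k x * (f x - regressionFunction ρ x) ∂ρ.fst := by
  have h1 : Integrable (fun p : X × ℝ => k p.1 * (f p.1 - p.2)) ρ :=
    (hk.comp_measurePreserving measurePreserving_fst').integrable_mul (memLp_residual hy hf)
  rw [← Measure.integral_condKernel h1]
  refine integral_congr_ae ?_
  filter_upwards [((memLp_snd hy).integrable (by norm_num)).condKernel_ae] with x hx
  rw [integral_const_mul, integral_sub (integrable_const _) hx]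
  simp [regressionFunction]

/-- Pythagoras: `r(x) - y` is orthogonal in `L²(ρ)` to square-integrable functions of `x` alone. -/
theorem integral_residual_sq (hy : Integrable (fun p : X × ℝ => p.2 ^ 2) ρ) {f : X → ℝ}
    (hf : MemLp f 2 ρ.fst) (hr : MemLp (regressionFunction ρ) 2 ρ.fst) :
    ∫ p, (f p.1 - p.2) ^ 2 ∂ρ =
      ∫ x, (f x - regressionFunction ρ x) ^ 2 ∂ρ.fst +
        expectedRisk ρ (regressionFunction ρ) := by
  set r := regressionFunction ρ
  have hfr : MemLp (fun x => f x - r x) 2 ρ.fst := hf.sub hr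
  have hc : ∫ p : X × ℝ, (f p.1 - r p.1) * (r p.1 - p.2) ∂ρ = 0 := by
    rw [integral_mul_residual hy hfr hr]
    simp [r]
  have hfr' := hfr.comp_measurePreserving (measurePreserving_fst' (ρ := ρ))
  have i1 : Integrable (fun p : X × ℝ => (f p.1 - r p.1) ^ 2) ρ := hfr'.integrable_sq
  have i2 : Integrable (fun p : X × ℝ => (r p.1 - p.2) ^ 2) ρ :=
    (memLp_residual hy hr).integrable_sq
  have i12 : Integrable (fun p : X × ℝ => (f p.1 - r p.1) ^ 2 + (r p.1 - p.2) ^ 2) ρ := i1.add i2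
  have i3 : Integrable (fun p : X × ℝ => (f p.1 - r p.1) * (r p.1 - p.2)) ρ :=
    hfr'.integrable_mul (memLp_residual hy hr)
  have : ∀ p : X × ℝ, (f p.1 - p.2) ^ 2 = (f p.1 - r p.1) ^ 2 + (r p.1 - p.2) ^ 2 +
      2 * ((f p.1 - r p.1) * (r p.1 - p.2)) := fun p => by ring
  simp_rw [this]
  rw [integral_add i12 (i3.const_mul 2), integral_add i1 i2, integral_const_mul, hc,
    ← integral_comp_fst hfr.integrable_sq.aestronglyMeasurable, expectedRisk]
  ring

end LeastSquares

/-! ### Passage between real functions and the operator on complex `L²`. -/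

section KernelIntegral

variable {X : Type*} [MeasurableSpace X]

/-- The function `L_K f = ∫ f(x) K(x, ·) dν(x)` for a real-valued function `f`. -/
noncomputable def kernelIntegral (ν : Measure X) (K : X → X → ℝ) (f : X → ℝ) (u : X) : ℝ :=
  ∫ x, K x u * f x ∂ν

variable {ν : Measure X} {K : X → X → ℝ}

theorem enorm_eq_eLpNorm_of_ae_eq {F : Lp ℂ 2 ν} {f : X → ℝ} (hF : F =ᵐ[ν] fun x => (f x : ℂ)) :
    ‖F‖ₑ = eLpNorm f 2 ν := by
  rw [Lp.enorm_def, eLpNorm_congr_ae hF]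
  exact eLpNorm_congr_norm_ae (Filter.Eventually.of_forall fun x => by simp)

theorem memLp_of_ae_eq {F : Lp ℂ 2 ν} {f : X → ℝ} (hF : F =ᵐ[ν] fun x => (f x : ℂ)) :
    MemLp f 2 ν := by
  have := ((memLp_congr_ae hF).1 (Lp.memLp F)).re
  simpa using this

theorem exists_ae_eq_ofReal {f : X → ℝ} (hf : MemLp f 2 ν) :
    ∃ F : Lp ℂ 2 ν, F =ᵐ[ν] fun x => (f x : ℂ) :=
  ⟨_, (hf.ofReal (K := ℂ)).coeFn_toLp⟩

variable [IsProbabilityMeasure ν]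

theorem integralOperator_apply_of_ae_eq (hM : MemLp (Function.uncurry K) 2 (ν.prod ν))
    {F : Lp ℂ 2 ν} {f : X → ℝ} (hF : F =ᵐ[ν] fun x => (f x : ℂ)) :
    integralOperator ν K F =ᵐ[ν] fun u => (kernelIntegral ν K f u : ℂ) := by
  filter_upwards [integralOperator_apply hM F] with u hu
  rw [hu, kernelIntegral, ← integral_complex_ofReal]
  refine integral_congr_ae ?_
  filter_upwards [hF] with x hx
  rw [hx]
  push_cast
  rfl

theorem one_sub_smul_integralOperator_apply (hM : MemLp (Function.uncurry K) 2 (ν.prod ν))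
    {F : Lp ℂ 2 ν} {f : X → ℝ} (hF : F =ᵐ[ν] fun x => (f x : ℂ)) (η : ℝ) :
    (1 - η • integralOperator ν K) F =ᵐ[ν]
      fun u => ((f u - η * kernelIntegral ν K f u : ℝ) : ℂ) := by
  have h1 : (1 - η • integralOperator ν K) F = F - η • integralOperator ν K F := rfl
  rw [h1]
  filter_upwards [Lp.coeFn_sub F (η • integralOperator ν K F),
    Lp.coeFn_smul η (integralOperator ν K F), hF, integralOperator_apply_of_ae_eq hM hF]
    with u h1 h2 h3 h4
  rw [h1, Pi.sub_apply, h2, Pi.smul_apply, h3, h4]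
  simp

theorem memLp_kernelIntegral (hM : MemLp (Function.uncurry K) 2 (ν.prod ν)) {f : X → ℝ}
    (hf : MemLp f 2 ν) : MemLp (kernelIntegral ν K f) 2 ν := by
  obtain ⟨F, hF⟩ := exists_ae_eq_ofReal hf
  exact memLp_of_ae_eq (integralOperator_apply_of_ae_eq hM hF)

theorem eLpNorm_sub_kernelIntegral_le {V : Type*} [MeasurableSpace V] {μ : Measure V}
    [IsProbabilityMeasure μ] {φ : V → X → ℝ} {κ : ℝ} (hB : IsBoundedFeature μ ν φ K κ)
    (hK : IsRandomFeatureKernel μ ν φ K) {η : ℝ} (hη : 0 ≤ η) (hηκ : η * κ ^ 2 ≤ 1)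
    {f : X → ℝ} (hf : MemLp f 2 ν) :
    eLpNorm (fun u => f u - η * kernelIntegral ν K f u) 2 ν ≤ eLpNorm f 2 ν := by
  obtain ⟨F, hF⟩ := exists_ae_eq_ofReal hf
  rw [← enorm_eq_eLpNorm_of_ae_eq hF, ← enorm_eq_eLpNorm_of_ae_eq
    (one_sub_smul_integralOperator_apply (hB.memLp_kernel hK) hF η)]
  have h1 : ‖1 - η • integralOperator ν K‖ ≤ 1 :=
    norm_one_sub_smul_le (hB.integralOperator_nonneg hK) hη
      ((mul_le_mul_of_nonneg_left (hB.norm_integralOperator_le hK) hη).trans hηκ)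
  rw [← ofReal_norm, ← ofReal_norm]
  refine ENNReal.ofReal_le_ofReal ?_
  simpa using ContinuousLinearMap.le_of_opNorm_le _ h1 F

end KernelIntegral

/-! ### Moments of the stochastic gradient and the one-step estimate. -/

section OneStep

variable {V X : Type*} [MeasurableSpace V] [MeasurableSpace X]
  {ρ : Measure (X × ℝ)} [IsProbabilityMeasure ρ] {μ : Measure V} [IsProbabilityMeasure μ]
  {φ : V → X → ℝ} {K : X → X → ℝ} {κ : ℝ}

theorem expectedRisk_nonneg {ρ : Measure (X × ℝ)} {f : X → ℝ} : 0 ≤ expectedRisk ρ f :=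
  integral_nonneg fun _ => sq_nonneg _

/-- The stochastic gradient of the squared loss at `f`, evaluated at the point `u`. -/
def stochasticGradient (φ : V → X → ℝ) (f : X → ℝ) (w : (X × ℝ) × V) (u : X) : ℝ :=
  (f w.1.1 - w.1.2) * (φ w.2 w.1.1 * φ w.2 u)

theorem measurable_stochasticGradient (hφ : Measurable (Function.uncurry φ)) {f : X → ℝ}
    (hf : Measurable f) :
    Measurable fun p : ((X × ℝ) × V) × X => stochasticGradient φ f p.1 p.2 := by
  have e1 : Measurable fun p : ((X × ℝ) × V) × X => φ p.1.2 p.1.1.1 :=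
    hφ.comp (f := fun p : ((X × ℝ) × V) × X => (p.1.2, p.1.1.1)) (by fun_prop)
  have e2 : Measurable fun p : ((X × ℝ) × V) × X => φ p.1.2 p.2 :=
    hφ.comp (f := fun p : ((X × ℝ) × V) × X => (p.1.2, p.2)) (by fun_prop)
  have e3 : Measurable fun p : ((X × ℝ) × V) × X => f p.1.1.1 - p.1.1.2 := by fun_prop
  exact e3.mul (e1.mul e2)

theorem ae_abs_stochasticGradient_le (hB : IsBoundedFeature μ ρ.fst φ K κ)
    (hK : IsRandomFeatureKernel μ ρ.fst φ K) (f : X → ℝ) {u : X}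
    (hu : ∀ᵐ v ∂μ, |φ v u| ≤ κ) :
    ∀ᵐ w ∂ρ.prod μ, ‖stochasticGradient φ f w u‖ ≤ κ ^ 2 * ‖f w.1.1 - w.1.2‖ := by
  have h1 : ∀ᵐ w ∂ρ.prod μ, |φ w.2 w.1.1| ≤ κ :=
    (Measure.measurePreserving_swap.comp
      ((measurePreserving_fst' (ρ := ρ)).prod (MeasurePreserving.id μ))).quasiMeasurePreserving.ae
      (hB.ae_abs_feature_le hK)
  filter_upwards [h1, Measure.quasiMeasurePreserving_snd.ae hu] with w h1 h2
  rw [stochasticGradient, norm_mul, norm_mul, mul_comm, sq, Real.norm_eq_abs (φ _ _),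
    Real.norm_eq_abs (φ _ _)]
  gcongr
  linarith [hB.one_le]

theorem memLp_stochasticGradient (hB : IsBoundedFeature μ ρ.fst φ K κ)
    (hK : IsRandomFeatureKernel μ ρ.fst φ K) (hy : Integrable (fun p : X × ℝ => p.2 ^ 2) ρ)
    {f : X → ℝ} (hf : MemLp f 2 ρ.fst)
    (hfm : Measurable f) {u : X}
    (hu : ∀ᵐ v ∂μ, |φ v u| ≤ κ) : MemLp (fun w => stochasticGradient φ f w u) 2 (ρ.prod μ) :=
  ((memLp_residual hy hf).comp_fst μ).of_le_mul
    ((measurable_stochasticGradient hK.measurable_feature hfm).comp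
      measurable_prodMk_right).aestronglyMeasurable
    (ae_abs_stochasticGradient_le hB hK f hu)

theorem integral_stochasticGradient (hB : IsBoundedFeature μ ρ.fst φ K κ)
    (hK : IsRandomFeatureKernel μ ρ.fst φ K) (hy : Integrable (fun p : X × ℝ => p.2 ^ 2) ρ)
    {f : X → ℝ} (hf : MemLp f 2 ρ.fst)
    (hfm : Measurable f) {u : X}
    (hu : ∀ᵐ v ∂μ, |φ v u| ≤ κ) (hKu : MemLp (fun x => K x u) 2 ρ.fst) :
    ∫ w, stochasticGradient φ f w u ∂ρ.prod μ =
      kernelIntegral ρ.fst K (fun x => f x - regressionFunction ρ x) u := by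
  have hi := (memLp_stochasticGradient hB hK hy hf hfm hu).integrable (by norm_num)
  rw [integral_prod _ hi, kernelIntegral, ← integral_mul_residual hy hKu hf]
  congr 1
  ext p
  simp only [stochasticGradient]
  rw [integral_const_mul, ← hK.kernel_eq, mul_comm]

theorem integral_stochasticGradient_sq_le (hB : IsBoundedFeature μ ρ.fst φ K κ)
    (hK : IsRandomFeatureKernel μ ρ.fst φ K) (hy : Integrable (fun p : X × ℝ => p.2 ^ 2) ρ)
    {f : X → ℝ} (hf : MemLp f 2 ρ.fst)
    (hfm : Measurable f) {u : X} (hu : ∀ᵐ v ∂μ, |φ v u| ≤ κ) :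
    ∫ w, stochasticGradient φ f w u ^ 2 ∂ρ.prod μ ≤ κ ^ 4 * ∫ p, (f p.1 - p.2) ^ 2 ∂ρ := by
  have h2 : ∫ w : (X × ℝ) × V, (f w.1.1 - w.1.2) ^ 2 ∂ρ.prod μ = ∫ p, (f p.1 - p.2) ^ 2 ∂ρ := by
    simpa using integral_fun_fst (μ := ρ) (ν := μ) (fun p : X × ℝ => (f p.1 - p.2) ^ 2)
  rw [← h2, ← integral_const_mul]
  refine integral_mono_ae (memLp_stochasticGradient hB hK hy hf hfm hu).integrable_sq
    (((memLp_residual hy hf).comp_fst μ).integrable_sq.const_mul _) ?_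
  filter_upwards [ae_abs_stochasticGradient_le hB hK f hu] with w hw
  have := pow_le_pow_left₀ (norm_nonneg _) hw 2
  rw [mul_pow, ← norm_pow, ← norm_pow, Real.norm_of_nonneg (sq_nonneg _),
    Real.norm_of_nonneg (sq_nonneg _), ← pow_mul] at this
  exact this

theorem lintegral_sub_stochasticGradient_le (hB : IsBoundedFeature μ ρ.fst φ K κ)
    (hK : IsRandomFeatureKernel μ ρ.fst φ K) (hy : Integrable (fun p : X × ℝ => p.2 ^ 2) ρ)
    {f : X → ℝ} (hf : MemLp f 2 ρ.fst)
    (hfm : Measurable f) {u : X} (hu : ∀ᵐ v ∂μ, |φ v u| ≤ κ)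
    (hKu : MemLp (fun x => K x u) 2 ρ.fst) (a η : ℝ) :
    ∫⁻ w, ‖a - η * stochasticGradient φ f w u‖ₑ ^ 2 ∂ρ.prod μ ≤
      ‖a - η * kernelIntegral ρ.fst K (fun x => f x - regressionFunction ρ x) u‖ₑ ^ 2 +
        ENNReal.ofReal (η ^ 2 * κ ^ 4 * ∫ p, (f p.1 - p.2) ^ 2 ∂ρ) := by
  have hG := memLp_stochasticGradient hB hK hy hf hfm hu
  have hmem : MemLp (fun w => a - η * stochasticGradient φ f w u) 2 (ρ.prod μ) :=
    (memLp_const a).sub (hG.const_mul η)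
  rw [← sq_eLpNorm_two, eLpNorm_two_sq_eq_ofReal hmem, Real.enorm_eq_ofReal_abs,
    ← ENNReal.ofReal_pow (abs_nonneg _), sq_abs, ← ENNReal.ofReal_add (sq_nonneg _)
      (mul_nonneg (by positivity) (integral_nonneg fun p => sq_nonneg _))]
  refine ENNReal.ofReal_le_ofReal ?_
  have i1 := (hG.integrable (by norm_num)).const_mul (-(2 * a * η))
  have i2 := hG.integrable_sq.const_mul (η ^ 2)
  have i12 : Integrable (fun w => -(2 * a * η) * stochasticGradient φ f w u +
      η ^ 2 * stochasticGradient φ f w u ^ 2) (ρ.prod μ) := i1.add i2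
  have e : ∀ w, (a - η * stochasticGradient φ f w u) ^ 2 =
      a ^ 2 + (-(2 * a * η) * stochasticGradient φ f w u +
        η ^ 2 * stochasticGradient φ f w u ^ 2) := fun w => by ring
  simp_rw [e]
  rw [integral_add (integrable_const _) i12, integral_add i1 i2, integral_const_mul,
    integral_const_mul, integral_stochasticGradient hB hK hy hf hfm hu hKu]
  have h := mul_le_mul_of_nonneg_left (integral_stochasticGradient_sq_le hB hK hy hf hfm hu)
    (sq_nonneg η)
  simp only [integral_const, probReal_univ, smul_eq_mul, one_mul]
  -- The square of the mean gradient occurs on the right after expanding but not on the left; it is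
  -- discarded, the variance being bounded by the second moment.
  nlinarith [sq_nonneg
    (η * kernelIntegral ρ.fst K (fun x => f x - regressionFunction ρ x) u)]

/-- One step of the algorithm, compared with one step of the population gradient iteration started
from `regressionFunction ρ + q`. -/
theorem lintegral_step_le (hB : IsBoundedFeature μ ρ.fst φ K κ)
    (hK : IsRandomFeatureKernel μ ρ.fst φ K) (hy : Integrable (fun p : X × ℝ => p.2 ^ 2) ρ)
    {f : X → ℝ} (hfm : Measurable f)
    (hr : MemLp (regressionFunction ρ) 2 ρ.fst) {q : X → ℝ}
    (hq : MemLp q 2 ρ.fst) {η : ℝ} (hη : 0 ≤ η) (hηκ : η * κ ^ 2 ≤ 1) :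
    ∫⁻ w, eLpNorm (fun u => f u - η * stochasticGradient φ f w u - regressionFunction ρ u -
        (q u - η * kernelIntegral ρ.fst K q u)) 2 ρ.fst ^ 2 ∂ρ.prod μ ≤
      eLpNorm (fun u => f u - regressionFunction ρ u - q u) 2 ρ.fst ^ 2 +
        ENNReal.ofReal (η ^ 2 * κ ^ 4) *
          (eLpNorm (fun u => f u - regressionFunction ρ u) 2 ρ.fst ^ 2 +
            ENNReal.ofReal (expectedRisk ρ (regressionFunction ρ))) := by
  set r := regressionFunction ρ with hrdef
  have hM := hB.memLp_kernel hK
  have hrm : Measurable r := measurable_regressionFunction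
  -- Outside `L²` the right side is infinite. The estimate thus holds for every measurable `f`, and
  -- no square-integrability of individual sample paths has to be proved.
  by_cases hs : MemLp (fun u => f u - r u - q u) 2 ρ.fst
  swap
  · have : eLpNorm (fun u => f u - r u - q u) 2 ρ.fst = ∞ := by
      by_contra h
      exact hs ⟨(hfm.sub hrm).aestronglyMeasurable.sub hq.1, lt_top_iff_ne_top.2 h⟩
    rw [this]
    simp
  have hfr : MemLp (fun u => f u - r u) 2 ρ.fst := by
    convert hs.add hq using 1
    ext u
    simp
  have hf : MemLp f 2 ρ.fst := by
    convert hfr.add hr using 1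
    ext u
    simp
  have hLq := memLp_kernelIntegral hM hq
  simp_rw [sq_eLpNorm_two (m := ρ.fst)]
  -- Integrating over the sample first, at a fixed point `u`, reduces the claim to a scalar
  -- second-moment computation.
  rw [lintegral_lintegral_swap]
  swap
  · have e1 : AEStronglyMeasurable (fun u => q u - η * kernelIntegral ρ.fst K q u) ρ.fst :=
      hq.1.sub (hLq.1.const_mul η)
    have e2 : Measurable (fun p : ((X × ℝ) × V) × X =>
        f p.2 - η * stochasticGradient φ f p.1 p.2 - r p.2) :=
      ((hfm.comp measurable_snd).sub
        ((measurable_stochasticGradient hK.measurable_feature hfm).const_mul η)).sub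
        (hrm.comp measurable_snd)
    exact ((e2.aestronglyMeasurable.sub e1.comp_snd).enorm).pow_const 2
  set D := ∫ p, (f p.1 - p.2) ^ 2 ∂ρ with hD
  have hstep : ∀ᵐ u ∂ρ.fst, ∫⁻ w, ‖f u - η * stochasticGradient φ f w u - r u -
      (q u - η * kernelIntegral ρ.fst K q u)‖ₑ ^ 2 ∂ρ.prod μ ≤
      ‖(f u - r u - q u) - η * kernelIntegral ρ.fst K (fun u => f u - r u - q u) u‖ₑ ^ 2 +
        ENNReal.ofReal (η ^ 2 * κ ^ 4 * D) := by
    filter_upwards [hB.ae_ae_abs_feature_le hK, memLp_section hM] with u hu hKu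
    have h := lintegral_sub_stochasticGradient_le hB hK hy hf hfm hu hKu
      (f u - r u - (q u - η * kernelIntegral ρ.fst K q u)) η
    have hlin : kernelIntegral ρ.fst K (fun u => f u - r u - q u) u =
        kernelIntegral ρ.fst K (fun u => f u - r u) u - kernelIntegral ρ.fst K q u := by
      simp only [kernelIntegral]
      have j1 : Integrable (fun x => K x u * (f x - r x)) ρ.fst := hKu.integrable_mul hfr
      have j2 : Integrable (fun x => K x u * q x) ρ.fst := hKu.integrable_mul hq
      rw [← integral_sub j1 j2]
      simp_rw [mul_sub]
    rw [hlin]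
    rw [← hrdef] at h
    -- By linearity the mean updates of `f - r` and of `q` combine into the map `1 - ηL` acting on
    -- `f - r - q`.
    convert h using 3
    · congr 2
      ring
    · congr 1
      ring
  refine (lintegral_mono_ae hstep).trans ?_
  rw [lintegral_add_right _ measurable_const, lintegral_const, measure_univ, mul_one]
  refine add_le_add ?_ (le_of_eq ?_)
  · rw [← sq_eLpNorm_two, ← sq_eLpNorm_two]
    gcongr
    exact eLpNorm_sub_kernelIntegral_le hB hK hη hηκ hs
  · rw [← sq_eLpNorm_two, eLpNorm_two_sq_eq_ofReal hfr, ← ENNReal.ofReal_add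
      (integral_nonneg fun u => sq_nonneg _) (expectedRisk_nonneg),
      ← ENNReal.ofReal_mul (by positivity), hD, integral_residual_sq hy hf hr]

end OneStep

/-! ### Dependence of the iterates on past samples, and conditioning on the past. -/

section Path

variable {V X : Type*} [MeasurableSpace V] [MeasurableSpace X]

/-- Factoring through the first `t` samples gives both joint measurability and independence of the
iterate from sample `t`. -/
theorem exists_measurable_iterate {φ : V → X → ℝ} (hφ : Measurable (Function.uncurry φ))
    (lam : ℝ) (η : ℕ → ℝ) (t : ℕ) :
    ∃ F : (Fin t → (X × ℝ) × V) × X → ℝ, Measurable F ∧ ∀ (z : ℕ → X × ℝ) (v : ℕ → V) (x : X),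
      iterate φ lam η z v t x = F (fun i => (z i, v i), x) := by
  induction t with
  | zero => exact ⟨fun _ => 0, measurable_const, fun _ _ _ => rfl⟩
  | succ t ih =>
    obtain ⟨F, hF, h⟩ := ih
    have m0 : Measurable fun p : (Fin (t + 1) → (X × ℝ) × V) × X => p.1 (Fin.last t) :=
      (measurable_pi_apply _).comp measurable_fst
    have mi : Measurable fun p : (Fin (t + 1) → (X × ℝ) × V) × X =>
        fun i : Fin t => p.1 i.castSucc :=
      measurable_pi_lambda _ fun i => (measurable_pi_apply _).comp measurable_fst
    refine ⟨fun p => (1 - η t * lam) * F (fun i => p.1 i.castSucc, p.2) -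
      η t * (F (fun i => p.1 i.castSucc, (p.1 (Fin.last t)).1.1) - (p.1 (Fin.last t)).1.2) *
        φ (p.1 (Fin.last t)).2 (p.1 (Fin.last t)).1.1 * φ (p.1 (Fin.last t)).2 p.2, ?_, ?_⟩
    · have e1 := hF.comp (mi.prodMk measurable_snd)
      have e2 := hF.comp (mi.prodMk m0.fst.fst)
      have e3 := hφ.comp (m0.snd.prodMk m0.fst.fst)
      have e4 := hφ.comp (m0.snd.prodMk measurable_snd)
      exact (e1.const_mul _).sub ((((e2.sub m0.fst.snd).const_mul _).mul e3).mul e4)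
    · intro z v x
      simp only [iterate, h, Fin.val_castSucc, Fin.val_last]

theorem measurable_eLpNorm_two_sq {A : Type*} [MeasurableSpace A] {ν : Measure X} [SFinite ν]
    {G : A × X → ℝ} (hG : Measurable G) :
    Measurable fun a => eLpNorm (fun u => G (a, u)) 2 ν ^ 2 := by
  simp_rw [sq_eLpNorm_two]
  exact (hG.enorm.pow_const 2).lintegral_prod_right'

theorem measurable_kernelIntegral {ν : Measure X} [SFinite ν] {K : X → X → ℝ} {q : X → ℝ}
    (hK : Measurable (Function.uncurry K)) (hq : Measurable q) :
    Measurable (kernelIntegral ν K q) := by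
  have h : Measurable fun p : X × X => K p.1 p.2 * q p.1 := hK.mul (hq.comp measurable_fst)
  exact (h.stronglyMeasurable.integral_prod_left' (μ := ν)).measurable

/-- Plays the role of conditional expectation: the past is frozen while the fresh sample is
integrated over its law. -/
theorem lintegral_prodMk_of_indepFun {Ω A W : Type*} [MeasurableSpace Ω] [MeasurableSpace A]
    [MeasurableSpace W] {P : Measure Ω} [IsProbabilityMeasure P] {f : Ω → A} {g : Ω → W}
    (hf : Measurable f) (hg : Measurable g) (h : f ⟂ᵢ[P] g) {G : A × W → ℝ≥0∞}
    (hG : Measurable G) :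
    ∫⁻ ω, G (f ω, g ω) ∂P = ∫⁻ ω, ∫⁻ w, G (f ω, w) ∂(P.map g) ∂P := by
  rw [← lintegral_map hG (hf.prodMk hg),
    (indepFun_iff_map_prod_eq_prod_map_map hf.aemeasurable hg.aemeasurable).1 h,
    lintegral_prod _ hG.aemeasurable, lintegral_map hG.lintegral_prod_right' hf]

theorem indepFun_past {Ω W : Type*} [MeasurableSpace Ω] [MeasurableSpace W] {P : Measure Ω}
    {T : ℕ} {w : ℕ → Ω → W} (hw : ∀ t < T, Measurable (w t))
    (hi : iIndepFun (fun (t : Fin T) ω => w t ω) P) {t : ℕ} (ht : t < T) :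
    (fun ω (i : Fin t) => w i ω) ⟂ᵢ[P] w t := by
  classical
  let S : Finset (Fin T) := Finset.univ.filter fun i => (i : ℕ) < t
  have h := hi.indepFun_finset S {⟨t, ht⟩} (by simp [S]) fun i => hw i i.2
  have hm : ∀ i : Fin t, (⟨i, i.2.trans ht⟩ : Fin T) ∈ S := fun i => by simp [S]
  have m1 : Measurable fun (p : S → W) (i : Fin t) => p ⟨_, hm i⟩ :=
    measurable_pi_lambda _ fun i => measurable_pi_apply _
  have m2 : Measurable fun p : ({⟨t, ht⟩} : Finset (Fin T)) → W =>
      p ⟨⟨t, ht⟩, Finset.mem_singleton_self _⟩ := measurable_pi_apply _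
  exact h.comp m1 m2

variable {ρ : Measure (X × ℝ)} [IsProbabilityMeasure ρ] {μ : Measure V} [IsProbabilityMeasure μ]
  {φ : V → X → ℝ} {K : X → X → ℝ} {κ : ℝ}
  {Ω : Type*} [MeasurableSpace Ω] {P : Measure Ω} [IsProbabilityMeasure P]

theorem lintegral_iterate_succ_le (hB : IsBoundedFeature μ ρ.fst φ K κ)
    (hK : IsRandomFeatureKernel μ ρ.fst φ K) (hy : Integrable (fun p : X × ℝ => p.2 ^ 2) ρ)
    (hr : MemLp (regressionFunction ρ) 2 ρ.fst) {T : ℕ} {z : ℕ → Ω → X × ℝ} {v : ℕ → Ω → V}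
    (hz : ∀ t < T, Measurable (z t)) (hv : ∀ t < T, Measurable (v t))
    (hlaw : ∀ t < T, P.map (fun ω => (z t ω, v t ω)) = ρ.prod μ)
    (hind : iIndepFun (fun (t : Fin T) ω => (z t ω, v t ω)) P)
    {η : ℕ → ℝ} {t : ℕ} (ht : t < T) (hη : 0 ≤ η t) (hηκ : η t * κ ^ 2 ≤ 1)
    {q : X → ℝ} (hqm : Measurable q) (hq : MemLp q 2 ρ.fst) :
    ∫⁻ ω, eLpNorm (fun u => iterate φ 0 η (fun t => z t ω) (fun t => v t ω) (t + 1) u -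
        regressionFunction ρ u - (q u - η t * kernelIntegral ρ.fst K q u)) 2 ρ.fst ^ 2 ∂P ≤
      ∫⁻ ω, eLpNorm (fun u => iterate φ 0 η (fun t => z t ω) (fun t => v t ω) t u -
        regressionFunction ρ u - q u) 2 ρ.fst ^ 2 ∂P +
        ENNReal.ofReal (η t ^ 2 * κ ^ 4) *
          (∫⁻ ω, eLpNorm (fun u => iterate φ 0 η (fun t => z t ω) (fun t => v t ω) t u -
            regressionFunction ρ u) 2 ρ.fst ^ 2 ∂P +
            ENNReal.ofReal (expectedRisk ρ (regressionFunction ρ))) := by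
  obtain ⟨F, hF, hiter⟩ := exists_measurable_iterate hK.measurable_feature 0 η t
  have hw : ∀ t < T, Measurable fun ω => (z t ω, v t ω) := fun t ht => (hz t ht).prodMk (hv t ht)
  let past : Ω → Fin t → (X × ℝ) × V := fun ω i => (z i ω, v i ω)
  have hpm : Measurable past := measurable_pi_lambda _ fun i => hw i (i.2.trans ht)
  have hi : past ⟂ᵢ[P] fun ω => (z t ω, v t ω) := indepFun_past hw hind ht
  have hrm : Measurable (regressionFunction ρ) := measurable_regressionFunction
  have hLm : Measurable (kernelIntegral ρ.fst K q) :=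
    measurable_kernelIntegral hB.measurable_kernel hqm
  have hstep : ∀ ω u, iterate φ 0 η (fun t => z t ω) (fun t => v t ω) (t + 1) u =
      F (past ω, u) - η t * stochasticGradient φ (fun x => F (past ω, x)) (z t ω, v t ω) u := by
    intro ω u
    simp only [iterate, hiter, stochasticGradient, past]
    ring
  have hnow : ∀ ω u, iterate φ 0 η (fun t => z t ω) (fun t => v t ω) t u = F (past ω, u) :=
    fun ω u => hiter _ _ u
  simp_rw [hstep, hnow]
  clear_value past
  have hφ := hK.measurable_feature
  have hG : Measurable fun p : ((Fin t → (X × ℝ) × V) × ((X × ℝ) × V)) × X =>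
      F (p.1.1, p.2) - η t * stochasticGradient φ (fun x => F (p.1.1, x)) p.1.2 p.2 -
        regressionFunction ρ p.2 -
        (q p.2 - η t * kernelIntegral ρ.fst K q p.2) := by
    have m1 : Measurable fun p : ((Fin t → (X × ℝ) × V) × ((X × ℝ) × V)) × X => p.1.1 :=
      measurable_fst.comp measurable_fst
    have m2 : Measurable fun p : ((Fin t → (X × ℝ) × V) × ((X × ℝ) × V)) × X => p.1.2 :=
      measurable_snd.comp measurable_fst
    have m3 : Measurable fun p : ((Fin t → (X × ℝ) × V) × ((X × ℝ) × V)) × X => p.2 :=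
      measurable_snd
    have e1 := hF.comp (m1.prodMk m3)
    have e2 := hF.comp (m1.prodMk m2.fst.fst)
    have e3 := hφ.comp (m2.snd.prodMk m2.fst.fst)
    have e4 := hφ.comp (m2.snd.prodMk m3)
    exact ((e1.sub (((e2.sub m2.fst.snd).mul (e3.mul e4)).const_mul _)).sub (hrm.comp m3)).sub
      ((hqm.comp m3).sub ((hLm.comp m3).const_mul _))
  have hsplit := lintegral_prodMk_of_indepFun hpm (hw t ht) hi
    (measurable_eLpNorm_two_sq (ν := ρ.fst) hG)
  rw [hlaw t ht] at hsplit
  refine hsplit.le.trans ?_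
  have hA0 : Measurable fun p : (Fin t → (X × ℝ) × V) × X =>
      F (p.1, p.2) - regressionFunction ρ p.2 :=
    hF.sub (hrm.comp measurable_snd)
  have hS0 : Measurable fun p : (Fin t → (X × ℝ) × V) × X =>
      F (p.1, p.2) - regressionFunction ρ p.2 - q p.2 :=
    hA0.sub (hqm.comp measurable_snd)
  have hA : Measurable fun ω =>
      eLpNorm (fun u => F (past ω, u) - regressionFunction ρ u) 2 ρ.fst ^ 2 :=
    (measurable_eLpNorm_two_sq (ν := ρ.fst) hA0).comp hpm
  have hS : Measurable fun ω =>
      eLpNorm (fun u => F (past ω, u) - regressionFunction ρ u - q u) 2 ρ.fst ^ 2 :=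
    (measurable_eLpNorm_two_sq (ν := ρ.fst) hS0).comp hpm
  refine (lintegral_mono fun ω => lintegral_step_le hB hK hy (f := fun x => F (past ω, x))
    (hF.comp measurable_prodMk_left) hr hq hη hηκ).trans (le_of_eq ?_)
  rw [lintegral_add_left hS, lintegral_const_mul _ (hA.add_const _),
    lintegral_add_left hA, lintegral_const, measure_univ, mul_one]

end Path

/-! ### The bias: residual of the population iteration under the source condition. -/

section Population

variable {X : Type*} [MeasurableSpace X]

/-- The residual `f_t - f` of the gradient iteration `f_{t+1} = f_t - η L_K (f_t - f)` for the
target `f`, started from `f_0 = 0`. -/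
noncomputable def populationResidual (ν : Measure X) (K : X → X → ℝ) (η : ℝ) (f : X → ℝ) :
    ℕ → X → ℝ
  | 0 => fun x => -f x
  | t + 1 => fun x => populationResidual ν K η f t x -
      η * kernelIntegral ν K (populationResidual ν K η f t) x

variable {ν : Measure X} [IsProbabilityMeasure ν] {K : X → X → ℝ} {f : X → ℝ}

theorem measurable_populationResidual (hK : Measurable (Function.uncurry K)) (hf : Measurable f)
    (η : ℝ) (t : ℕ) : Measurable (populationResidual ν K η f t) := by
  induction t with
  | zero => exact hf.neg
  | succ t ih => exact ih.sub ((measurable_kernelIntegral hK ih).const_mul η)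

theorem one_sub_smul_pow_apply (hM : MemLp (Function.uncurry K) 2 (ν.prod ν))
    {F : Lp ℂ 2 ν} (hF : F =ᵐ[ν] fun x => (f x : ℂ)) (η : ℝ) (t : ℕ) :
    ((1 - η • integralOperator ν K) ^ t) (-F) =ᵐ[ν]
      fun u => (populationResidual ν K η f t u : ℂ) := by
  induction t with
  | zero =>
    rw [pow_zero, one_apply_eq_self]
    filter_upwards [Lp.coeFn_neg F, hF] with x h1 h2
    rw [h1, Pi.neg_apply, h2]
    simp [populationResidual]
  | succ t ih =>
    rw [pow_succ', mul_apply_eq_comp]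
    exact one_sub_smul_integralOperator_apply hM ih η

theorem eLpNorm_populationResidual_le {V : Type*} [MeasurableSpace V] {μ : Measure V}
    [IsProbabilityMeasure μ] {φ : V → X → ℝ} {κ : ℝ} (hB : IsBoundedFeature μ ν φ K κ)
    (hK : IsRandomFeatureKernel μ ν φ K) {η ζ R : ℝ} (hη : 0 < η) (hηκ : η * κ ^ 2 ≤ 1)
    (hζ : 0 < ζ) {t : ℕ} (ht : 0 < t) (hf : SourceCondition ν K ζ R f) :
    eLpNorm (populationResidual ν K η f t) 2 ν ≤ ENNReal.ofReal ((ζ / (η * t)) ^ ζ * R) := by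
  obtain ⟨g, hgR, hg⟩ := hf
  rw [← enorm_eq_eLpNorm_of_ae_eq (one_sub_smul_pow_apply (hB.memLp_kernel hK) hg η t),
    ← ofReal_norm]
  refine ENNReal.ofReal_le_ofReal ?_
  have hgn : ‖Complex.ofRealCLM.compLp g‖ ≤ R := by
    refine (ContinuousLinearMap.norm_compLp_le _ _).trans ?_
    rwa [Complex.ofRealCLM_norm, one_mul]
  have hop := norm_one_sub_smul_pow_mul_operatorPow_le (hB.integralOperator_nonneg hK) hη
    ((mul_le_mul_of_nonneg_left (hB.norm_integralOperator_le hK) hη.le).trans hηκ) hζ ht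
  rw [map_neg, norm_neg, ← mul_apply_eq_comp]
  refine (ContinuousLinearMap.le_of_opNorm_le _ hop _).trans ?_
  gcongr

end Population

/-! ### Recursive inequalities for the error and for the distance between the iterations. -/

section Recursion

/-- A discrete Grönwall inequality. -/
theorem add_le_of_forall_succ_le {T : ℕ} {a : ℕ → ℝ≥0∞} {δ E : ℝ≥0∞}
    (h : ∀ t < T, a (t + 1) ≤ a t + δ * (a t + E)) {t : ℕ} (ht : t ≤ T) :
    a t + E ≤ (1 + δ) ^ t * (a 0 + E) := by
  induction t with
  | zero => simp
  | succ t ih =>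
    calc a (t + 1) + E ≤ a t + δ * (a t + E) + E := by gcongr; exact h t ht
      _ = (1 + δ) * (a t + E) := by ring
      _ ≤ (1 + δ) * ((1 + δ) ^ t * (a 0 + E)) := by gcongr; exact ih (by omega)
      _ = (1 + δ) ^ (t + 1) * (a 0 + E) := by ring

/-- The increments of `s` are driven by `a`, which Grönwall bounds uniformly up to time `T`; summing
them costs only a factor `t`. -/
theorem le_of_forall_succ_le {T : ℕ} {a s : ℕ → ℝ≥0∞} {δ E : ℝ≥0∞}
    (h : ∀ t < T, a (t + 1) ≤ a t + δ * (a t + E))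
    (h' : ∀ t < T, s (t + 1) ≤ s t + δ * (a t + E)) (h0 : s 0 = 0) {t : ℕ} (ht : t ≤ T) :
    s t ≤ t * δ * ((1 + δ) ^ T * (a 0 + E)) := by
  induction t with
  | zero => simp [h0]
  | succ t ih =>
    have h1 : a t + E ≤ (1 + δ) ^ T * (a 0 + E) := by
      refine (add_le_of_forall_succ_le h (by omega)).trans ?_
      gcongr
      · exact le_self_add
      · omega
    calc s (t + 1) ≤ s t + δ * (a t + E) := h' t ht
      _ ≤ t * δ * ((1 + δ) ^ T * (a 0 + E)) + δ * ((1 + δ) ^ T * (a 0 + E)) := by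
          gcongr
          exact ih (by omega)
      _ = (t + 1 : ℕ) * δ * ((1 + δ) ^ T * (a 0 + E)) := by push_cast; ring

theorem eLpNorm_sub_sq_le {Y : Type*} [MeasurableSpace Y] {m : Measure Y} {f q : Y → ℝ}
    (hf : AEStronglyMeasurable f m) (hq : AEStronglyMeasurable q m) :
    eLpNorm f 2 m ^ 2 ≤
      2 * (eLpNorm (fun u => f u - q u) 2 m ^ 2 + eLpNorm q 2 m ^ 2) := by
  have h : eLpNorm f 2 m ≤ eLpNorm (fun u => f u - q u) 2 m + eLpNorm q 2 m := by
    have := eLpNorm_add_le (p := 2) (hf.sub hq) hq (by norm_num)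
    rw [sub_add_cancel] at this
    exact this
  calc eLpNorm f 2 m ^ 2 ≤ (eLpNorm (fun u => f u - q u) 2 m + eLpNorm q 2 m) ^ 2 := by gcongr
    _ ≤ 2 * (eLpNorm (fun u => f u - q u) 2 m ^ 2 + eLpNorm q 2 m ^ 2) := by
      have := ENNReal.rpow_add_le_mul_rpow_add_rpow (eLpNorm (fun u => f u - q u) 2 m)
        (eLpNorm q 2 m) (p := 2) (by norm_num)
      norm_num at this
      exact this

end Recursion

/-! ### Arithmetic of the step size. -/

section Rate

/-- The constant step size of the unregularized algorithm with `T` steps. -/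
noncomputable def stepSize (κ ζ : ℝ) (T : ℕ) : ℝ :=
  ζ / (8 * κ ^ 4 * (ζ + 1)) * (T : ℝ) ^ (-((2 * ζ + 1) / (2 * ζ + 2)))

variable {κ ζ : ℝ} {T : ℕ}

theorem stepSize_pos (hκ : 1 ≤ κ) (hζ : 0 < ζ) (hT : 2 ≤ T) : 0 < stepSize κ ζ T := by
  have : (0 : ℝ) < T := by exact_mod_cast (by omega : 0 < T)
  unfold stepSize
  positivity

theorem stepSize_mul_sq_le (hκ : 1 ≤ κ) (hζ : 0 < ζ) :
    ζ / (8 * κ ^ 4 * (ζ + 1)) * κ ^ 2 ≤ 1 := by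
  rw [div_mul_eq_mul_div, div_le_one (by positivity)]
  have h1 : 1 ≤ κ ^ 2 := one_le_pow₀ hκ
  have h2 : κ ^ 2 ≤ κ ^ 4 := pow_le_pow_right₀ hκ (by norm_num)
  nlinarith [mul_le_mul_of_nonneg_left h2 hζ.le]

theorem stepSize_mul_le_one (hκ : 1 ≤ κ) (hζ : 0 < ζ) (hT : 2 ≤ T) :
    stepSize κ ζ T * κ ^ 2 ≤ 1 := by
  have hT1 : (1 : ℝ) ≤ T := by exact_mod_cast (by omega : 1 ≤ T)
  have h : (T : ℝ) ^ (-((2 * ζ + 1) / (2 * ζ + 2))) ≤ 1 :=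
    Real.rpow_le_one_of_one_le_of_nonpos hT1 (by rw [Left.neg_nonpos_iff]; positivity)
  have h' := stepSize_mul_sq_le hκ hζ
  calc stepSize κ ζ T * κ ^ 2
      = ζ / (8 * κ ^ 4 * (ζ + 1)) * κ ^ 2 * (T : ℝ) ^ (-((2 * ζ + 1) / (2 * ζ + 2))) := by
        unfold stepSize; ring
    _ ≤ 1 * 1 := by gcongr
    _ = 1 := one_mul 1

/-- The exponent is `1 - (2ζ+1)/(ζ+1) = -ζ/(ζ+1)`: the variance side of the balance. -/
theorem card_mul_stepSize_sq_le (hκ : 1 ≤ κ) (hζ : 0 < ζ) (hT : 2 ≤ T) :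
    T * (stepSize κ ζ T ^ 2 * κ ^ 4) ≤ (T : ℝ) ^ (-(ζ / (ζ + 1))) := by
  have hT0 : (0 : ℝ) < T := by exact_mod_cast (by omega : 0 < T)
  have h' := stepSize_mul_sq_le hκ hζ
  have h2 : (T : ℝ) * ((T : ℝ) ^ (-((2 * ζ + 1) / (2 * ζ + 2)))) ^ 2 =
      (T : ℝ) ^ (-(ζ / (ζ + 1))) := by
    rw [← Real.rpow_natCast, ← Real.rpow_mul hT0.le]
    nth_rewrite 1 [← Real.rpow_one (T : ℝ)]
    rw [← Real.rpow_add hT0]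
    congr 1
    push_cast
    field_simp
    ring
  calc T * (stepSize κ ζ T ^ 2 * κ ^ 4)
      = (ζ / (8 * κ ^ 4 * (ζ + 1)) * κ ^ 2) ^ 2 *
        (T * ((T : ℝ) ^ (-((2 * ζ + 1) / (2 * ζ + 2)))) ^ 2) := by unfold stepSize; ring
    _ ≤ 1 ^ 2 * (T : ℝ) ^ (-(ζ / (ζ + 1))) := by rw [h2]; gcongr
    _ = (T : ℝ) ^ (-(ζ / (ζ + 1))) := by ring

/-- Here `ηT` is a constant times `T^(1/(2ζ+2))`, and the power `-2ζ` gives the same exponent: the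
bias side of the balance. -/
theorem div_stepSize_mul_rpow_sq (hκ : 1 ≤ κ) (hζ : 0 < ζ) (hT : 2 ≤ T) :
    ((ζ / (stepSize κ ζ T * T)) ^ ζ) ^ 2 =
      (8 * (κ ^ 2) ^ 2 * (ζ + 1)) ^ (2 * ζ) * (T : ℝ) ^ (-(ζ / (ζ + 1))) := by
  have hT0 : (0 : ℝ) < T := by exact_mod_cast (by omega : 0 < T)
  have h1 : ζ / (stepSize κ ζ T * T) =
      8 * (κ ^ 2) ^ 2 * (ζ + 1) * (T : ℝ) ^ (-(1 / (2 * ζ + 2))) := by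
    have h2 : (T : ℝ) ^ (-((2 * ζ + 1) / (2 * ζ + 2))) * T = (T : ℝ) ^ (1 / (2 * ζ + 2)) := by
      nth_rewrite 2 [← Real.rpow_one (T : ℝ)]
      rw [← Real.rpow_add hT0]
      congr 1
      field_simp
      ring
    rw [stepSize, mul_assoc, h2, Real.rpow_neg hT0.le]
    field_simp
  rw [h1, ← Real.rpow_natCast, ← Real.rpow_mul (by positivity),
    Real.mul_rpow (by positivity) (by positivity), ← Real.rpow_mul hT0.le]
  congr 2
  · push_cast; ring
  · push_cast; field_simp

theorem one_add_pow_le_three {δ : ℝ} (hδ : 0 ≤ δ) (h : T * δ ≤ 1) : (1 + δ) ^ T ≤ 3 := by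
  calc (1 + δ) ^ T ≤ Real.exp δ ^ T := by
        gcongr
        linarith [Real.add_one_le_exp δ]
    _ = Real.exp (T * δ) := by rw [← Real.exp_nat_mul]
    _ ≤ Real.exp 1 := by gcongr
    _ ≤ 3 := by linarith [Real.exp_one_lt_d9]

end Rate

/-! ### Combination of variance and bias. -/

section Main

variable {V X : Type*} [MeasurableSpace V] [MeasurableSpace X]
  {ρ : Measure (X × ℝ)} [IsProbabilityMeasure ρ] {μ : Measure V} [IsProbabilityMeasure μ]
  {φ : V → X → ℝ} {K : X → X → ℝ} {κ : ℝ}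
  {Ω : Type*} [MeasurableSpace Ω] {P : Measure Ω} [IsProbabilityMeasure P]

theorem lintegral_iterate_sub_le (hB : IsBoundedFeature μ ρ.fst φ K κ)
    (hK : IsRandomFeatureKernel μ ρ.fst φ K) (hy : Integrable (fun p : X × ℝ => p.2 ^ 2) ρ)
    (hr : MemLp (regressionFunction ρ) 2 ρ.fst) {T : ℕ} {z : ℕ → Ω → X × ℝ} {v : ℕ → Ω → V}
    (hz : ∀ t < T, Measurable (z t)) (hv : ∀ t < T, Measurable (v t))
    (hlaw : ∀ t < T, P.map (fun ω => (z t ω, v t ω)) = ρ.prod μ)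
    (hind : iIndepFun (fun (t : Fin T) ω => (z t ω, v t ω)) P)
    {η : ℕ → ℝ} {η₀ : ℝ} (hη₀ : ∀ t < T, η t = η₀) (hη : 0 ≤ η₀) (hηκ : η₀ * κ ^ 2 ≤ 1)
    (hδ : T * (η₀ ^ 2 * κ ^ 4) ≤ 1) :
    ∫⁻ ω, eLpNorm (fun u => iterate φ 0 η (fun t => z t ω) (fun t => v t ω) T u -
        regressionFunction ρ u) 2 ρ.fst ^ 2 ∂P ≤
      2 * (ENNReal.ofReal (T * (η₀ ^ 2 * κ ^ 4)) * (3 *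
          (eLpNorm (regressionFunction ρ) 2 ρ.fst ^ 2 +
            ENNReal.ofReal (expectedRisk ρ (regressionFunction ρ)))) +
        eLpNorm (populationResidual ρ.fst K η₀ (regressionFunction ρ) T) 2 ρ.fst ^ 2) := by
  have hM := hB.memLp_kernel hK
  have hrm : Measurable (regressionFunction ρ) := measurable_regressionFunction
  set q := populationResidual ρ.fst K η₀ (regressionFunction ρ) with hq
  have hqm : ∀ t, Measurable (q t) := measurable_populationResidual hB.measurable_kernel hrm η₀
  have hq2 : ∀ t, MemLp (q t) 2 ρ.fst := by
    intro t
    obtain ⟨F, hF⟩ := exists_ae_eq_ofReal hr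
    exact memLp_of_ae_eq (one_sub_smul_pow_apply hM hF η₀ t)
  set a : ℕ → ℝ≥0∞ := fun t => ∫⁻ ω, eLpNorm (fun u =>
    iterate φ 0 η (fun t => z t ω) (fun t => v t ω) t u - regressionFunction ρ u) 2 ρ.fst ^ 2 ∂P
    with ha
  set s : ℕ → ℝ≥0∞ := fun t => ∫⁻ ω, eLpNorm (fun u =>
    iterate φ 0 η (fun t => z t ω) (fun t => v t ω) t u - regressionFunction ρ u - q t u)
      2 ρ.fst ^ 2 ∂P with hs
  set δ := ENNReal.ofReal (η₀ ^ 2 * κ ^ 4) with hδdef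
  set E := ENNReal.ofReal (expectedRisk ρ (regressionFunction ρ))
  have hstep : ∀ t < T, ∀ q : X → ℝ, Measurable q → MemLp q 2 ρ.fst →
      ∫⁻ ω, eLpNorm (fun u => iterate φ 0 η (fun t => z t ω) (fun t => v t ω) (t + 1) u -
        regressionFunction ρ u - (q u - η₀ * kernelIntegral ρ.fst K q u)) 2 ρ.fst ^ 2 ∂P ≤
      ∫⁻ ω, eLpNorm (fun u => iterate φ 0 η (fun t => z t ω) (fun t => v t ω) t u -
        regressionFunction ρ u - q u) 2 ρ.fst ^ 2 ∂P + δ * (a t + E) := by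
    intro t ht q hqm hq2
    have h := lintegral_iterate_succ_le hB hK hy hr hz hv hlaw hind (η := η) ht
      (by rwa [hη₀ t ht]) (by rwa [hη₀ t ht]) hqm hq2
    rw [hη₀ t ht] at h
    exact h
  have h1 : ∀ t < T, a (t + 1) ≤ a t + δ * (a t + E) := by
    intro t ht
    -- Comparison with `q = 0`, which the population update fixes, gives the self-bounding recursion
    -- for the error.
    have h := hstep t ht (fun _ => 0) measurable_const (MemLp.zero' (p := 2))
    simpa [kernelIntegral] using h
  have h2 : ∀ t < T, s (t + 1) ≤ s t + δ * (a t + E) :=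
    fun t ht => hstep t ht (q t) (hqm t) (hq2 t)
  have ha0 : a 0 = eLpNorm (regressionFunction ρ) 2 ρ.fst ^ 2 := by
    simp only [ha, iterate, zero_sub, lintegral_const, measure_univ, mul_one]
    rw [← eLpNorm_neg (f := regressionFunction ρ)]
    rfl
  -- Both iterations start from the zero function, so their initial distance vanishes.
  have hs0 : s 0 = 0 := by simp [hs, hq, iterate, populationResidual]
  have h3 := le_of_forall_succ_le h1 h2 hs0 le_rfl
  have h4 : (1 + δ) ^ T ≤ 3 := by
    rw [hδdef, ← ENNReal.ofReal_one, ← ENNReal.ofReal_add zero_le_one (by positivity),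
      ← ENNReal.ofReal_pow (by positivity)]
    exact (ENNReal.ofReal_le_ofReal (one_add_pow_le_three (by positivity) hδ)).trans (by simp)
  have h5 : a T ≤ 2 * (s T + eLpNorm (q T) 2 ρ.fst ^ 2) := by
    obtain ⟨F, hF, hiter⟩ := exists_measurable_iterate hK.measurable_feature 0 η T
    have hm : ∀ ω, Measurable fun u =>
        iterate φ 0 η (fun t => z t ω) (fun t => v t ω) T u - regressionFunction ρ u := by
      intro ω
      simp_rw [hiter]
      exact (hF.comp measurable_prodMk_left).sub hrm
    refine (lintegral_mono fun ω => eLpNorm_sub_sq_le (hm ω).aestronglyMeasurable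
      (hq2 T).aestronglyMeasurable).trans (le_of_eq ?_)
    rw [lintegral_const_mul' _ _ (by norm_num), lintegral_add_right _ measurable_const,
      lintegral_const, measure_univ, mul_one]
  refine h5.trans ?_
  have h6 : ENNReal.ofReal (T * (η₀ ^ 2 * κ ^ 4)) = T * δ := by
    rw [ENNReal.ofReal_mul (Nat.cast_nonneg _), ENNReal.ofReal_natCast]
  rw [h6, ← ha0]
  gcongr
  refine h3.trans ?_
  gcongr

end Main

end DoublyStochastic

theorem mainTheorem3 :
    ∃ C : ℝ → ℝ → ℝ → ℝ → ℝ → ℝ,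
      ∀ (d : ℕ) (X : Set (EuclideanSpace ℝ (Fin d))) (_ : IsClosed X)
        (ρ : Measure (X × ℝ)) [IsProbabilityMeasure ρ]
        (_ : Integrable (fun p : X × ℝ => p.2 ^ 2) ρ)
        (V : Type*) [MeasurableSpace V] (μ : Measure V) [IsProbabilityMeasure μ]
        (φ : V → X → ℝ) (K : X → X → ℝ)
        (_ : DoublyStochastic.IsRandomFeatureKernel μ ρ.fst φ K)
        (κ : ℝ) (_ : DoublyStochastic.IsBoundedFeature μ ρ.fst φ K κ)
        (ζ R : ℝ) (_ : 0 < ζ) (_ : 0 < R)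
        (_ : DoublyStochastic.SourceCondition ρ.fst K ζ R
          (DoublyStochastic.regressionFunction ρ))
        (T : ℕ) (_ : 2 ≤ T)
        (Ω : Type*) [MeasurableSpace Ω] (P : Measure Ω) [IsProbabilityMeasure P]
        (z : ℕ → Ω → X × ℝ) (v : ℕ → Ω → V)
        (_ : ∀ t < T, Measurable (z t)) (_ : ∀ t < T, Measurable (v t))
        (_ : ∀ t < T, P.map (fun ω => (z t ω, v t ω)) = ρ.prod μ)
        (_ : iIndepFun (fun (t : Fin T) ω => (z t ω, v t ω)) P)
        (η : ℕ → ℝ)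
        (_ : ∀ t < T, η t = ζ / (8 * κ ^ 4 * (ζ + 1)) *
          (T : ℝ) ^ (-((2 * ζ + 1) / (2 * ζ + 2)))),
        ∫⁻ ω, eLpNorm (fun x =>
            DoublyStochastic.iterate φ 0 η (fun t => z t ω) (fun t => v t ω) T x -
              DoublyStochastic.regressionFunction ρ x) 2 ρ.fst ^ 2 ∂P ≤
          ENNReal.ofReal
            (C R ζ (eLpNorm (DoublyStochastic.regressionFunction ρ) 2 ρ.fst).toReal
                (DoublyStochastic.expectedRisk ρ (DoublyStochastic.regressionFunction ρ)) (κ ^ 2) *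
              ((T : ℝ) ^ (-(ζ / (ζ + 1))) * Real.log T)) := by
  -- The first summand is the bias, the second the variance: 2 from splitting the square, 3 from
  -- Grönwall. Dividing by `log 2` introduces the logarithm, since `log T ≥ log 2`.
  refine ⟨fun R ζ N E k => (2 * ((8 * k ^ 2 * (ζ + 1)) ^ (2 * ζ) * R ^ 2) + 6 * (N ^ 2 + E)) /
    Real.log 2, ?_⟩
  intro d X _ ρ _ hy V _ μ _ φ K hK κ hB ζ R hζ hR hsource T hT Ω _ P _ z v hz hv hlaw hind η hη
  have hκ := hB.one_le
  have hr : MemLp (DoublyStochastic.regressionFunction ρ) 2 ρ.fst := by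
    -- The source condition identifies `r` almost everywhere with an element of `L²`.
    obtain ⟨g, -, hg⟩ := hsource
    exact DoublyStochastic.memLp_of_ae_eq hg
  set r := DoublyStochastic.regressionFunction ρ with hrdef
  have hη₀ : 0 < DoublyStochastic.stepSize κ ζ T := DoublyStochastic.stepSize_pos hκ hζ hT
  have hηκ := DoublyStochastic.stepSize_mul_le_one hκ hζ hT
  have hδ := DoublyStochastic.card_mul_stepSize_sq_le hκ hζ hT
  set τ : ℝ := (T : ℝ) ^ (-(ζ / (ζ + 1))) with hτ
  have hτ0 : 0 ≤ τ := by positivity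
  have hτ1 : τ ≤ 1 := by
    refine Real.rpow_le_one_of_one_le_of_nonpos (by exact_mod_cast (by omega : 1 ≤ T)) ?_
    rw [Left.neg_nonpos_iff]
    positivity
  refine (DoublyStochastic.lintegral_iterate_sub_le hB hK hy hr hz hv hlaw hind
    (η₀ := DoublyStochastic.stepSize κ ζ T) hη hη₀.le hηκ
    (hδ.trans hτ1)).trans ?_
  have hbias := DoublyStochastic.eLpNorm_populationResidual_le hB hK hη₀ hηκ hζ
    (by omega : 0 < T) hsource
  have hE : 0 ≤ DoublyStochastic.expectedRisk ρ r := DoublyStochastic.expectedRisk_nonneg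
  set E := DoublyStochastic.expectedRisk ρ r
  set N := (eLpNorm r 2 ρ.fst).toReal with hN
  have hN' : eLpNorm r 2 ρ.fst = ENNReal.ofReal N :=
    (ENNReal.ofReal_toReal hr.eLpNorm_ne_top).symm
  have hN0 : 0 ≤ N := ENNReal.toReal_nonneg
  set B : ℝ := (8 * (κ ^ 2) ^ 2 * (ζ + 1)) ^ (2 * ζ) with hBdef
  have hB0 : 0 ≤ B := by positivity
  have hbias2 : eLpNorm (DoublyStochastic.populationResidual ρ.fst K
      (DoublyStochastic.stepSize κ ζ T) r T) 2 ρ.fst ^ 2 ≤ ENNReal.ofReal (B * τ * R ^ 2) := by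
    refine (pow_le_pow_left' hbias 2).trans (le_of_eq ?_)
    rw [← ENNReal.ofReal_pow (by positivity), mul_pow,
      DoublyStochastic.div_stepSize_mul_rpow_sq hκ hζ hT]
  calc _ ≤ 2 * (ENNReal.ofReal τ * (3 * (ENNReal.ofReal N ^ 2 + ENNReal.ofReal E)) +
        ENNReal.ofReal (B * τ * R ^ 2)) := by
        rw [hN']
        gcongr
    _ = ENNReal.ofReal (2 * (τ * (3 * (N ^ 2 + E)) + B * τ * R ^ 2)) := by
        rw [← ENNReal.ofReal_pow hN0, ← ENNReal.ofReal_add (by positivity) hE,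
          ← ENNReal.ofReal_ofNat 3, ← ENNReal.ofReal_mul (by norm_num),
          ← ENNReal.ofReal_mul hτ0, ← ENNReal.ofReal_add (by positivity) (by positivity),
          ← ENNReal.ofReal_ofNat 2, ← ENNReal.ofReal_mul (by norm_num)]
    _ ≤ _ := by
        refine ENNReal.ofReal_le_ofReal ?_
        have hlog2 : 0 < Real.log 2 := Real.log_pos one_lt_two
        have hlog : Real.log 2 ≤ Real.log T :=
          Real.log_le_log two_pos (by exact_mod_cast hT)
        rw [div_mul_eq_mul_div, le_div_iff₀ hlog2]
        calc 2 * (τ * (3 * (N ^ 2 + E)) + B * τ * R ^ 2) * Real.log 2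
            = (2 * (B * R ^ 2) + 6 * (N ^ 2 + E)) * (τ * Real.log 2) := by ring
          _ ≤ (2 * (B * R ^ 2) + 6 * (N ^ 2 + E)) * (τ * Real.log T) := by gcongr
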